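/- Let $n\ge 3$, and let $m_1,\dots,m_n$, $\lambda$ and $r_1,\dots,r_k$ be positive integers. Let $V_1,\dots,V_n$ be pairwise disjoint sets with $|V_i|=m_i$, and let $\lambda K^3_{m_1,\dots,m_n}$ be the multi-hypergraph with vertex set $V_1\cup\dots\cup V_n$ in which every set of three vertices from three different parts occurs as a hyperedge exactly $\lambda$ times, and which has no other hyperedges. The degree of a vertex in a (sub-)hypergraph is the number of hyperedges containing it, counted with multiplicity; an $r$-factor is a spanning sub-hypergraph in which every vertex has degree $r$; and a hypergraph is $(r_1,\dots,r_k)$-factorizable if its hyperedges can be partitioned into $k$ classes such that the $i$-th class forms an $r_i$-factor, for $i=1,\dots,k$. Then $\lambda K^3_{m_1,\dots,m_n}$ is $(r_1,\dots,r_k)$-factorizable if and only if there is an integer $m$ such that (i) $m_i=m$ for all $1\le i\le n$, (ii) $3$ divides $r_i m n$ for every $1\le i\le k$, and (iii) $\sum_{i=1}^{k} r_i=\lambda\binom{n-1}{2}m^2$. -/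

import Mathlib

/-- A finite hypergraph (with hinges): finite sets `V` of vertices, `E` of hyperedges and `H` of
hinges, together with a function `ψ : H → V` and a surjection `φ : H → E`. The hinge `h` attaches
the hyperedge `φ h` to the vertex `ψ h`. Loops and multiple hyperedges are allowed. -/
structure HingeHypergraph (V E H : Type*) [Finite V] [Finite E] [Finite H] where
  ψ : H → V
  φ : H → E
  φ_surjective : Function.Surjective φ

namespace HingeHypergraph

section
variable {V E H : Type*} [Finite V] [Finite E] [Finite H]

/-- The degree of a vertex is the number of hinges incident with it. -/
noncomputable def degree (G : HingeHypergraph V E H) (v : V) : ℕ :=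
  Nat.card {h : H // G.ψ h = v}

/-- Every vertex has degree `d`. -/
def IsRegular (G : HingeHypergraph V E H) (d : ℕ) : Prop :=
  ∀ v : V, G.degree v = d

/-- The spanning sub-hypergraph with hyperedge set `S`: it keeps all the vertices, the hyperedges
in `S`, and all the hinges of these hyperedges. -/
def spanningSub (G : HingeHypergraph V E H) (S : Set E) :
    HingeHypergraph V S {h : H // G.φ h ∈ S} where
  ψ h := G.ψ h.1
  φ h := ⟨G.φ h.1, h.2⟩
  φ_surjective := by
    rintro ⟨e, he⟩
    obtain ⟨h, rfl⟩ := G.φ_surjective e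
    exact ⟨⟨h, he⟩, rfl⟩

/-- The hyperedges in `S` form an `r`-factor, i.e. an `r`-regular spanning sub-hypergraph. -/
def IsFactor (G : HingeHypergraph V E H) (r : ℕ) (S : Set E) : Prop :=
  (G.spanningSub S).IsRegular r

/-- `G` has an `(r₁, …, r_k)`-factorization: its hyperedge set is the disjoint union of sets
`A₁, …, A_k`, where `A_i` is the hyperedge set of an `r_i`-factor. -/
def IsFactorizable (G : HingeHypergraph V E H) {k : ℕ} (r : Fin k → ℕ) : Prop :=
  ∃ A : Fin k → Set E,
    (∀ i j, i ≠ j → Disjoint (A i) (A j)) ∧ (⋃ i, A i) = Set.univ ∧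
      ∀ i, G.IsFactor (r i) (A i)

/-- `lam G`: every hyperedge of `G` is replaced by `lam` copies of it, each copy having its own
hinges, which attach it to the same vertices. -/
def multiple (lam : ℕ) (G : HingeHypergraph V E H) :
    HingeHypergraph V (E × Fin lam) (H × Fin lam) where
  ψ h := G.ψ h.1
  φ h := (G.φ h.1, h.2)
  φ_surjective := by
    rintro ⟨e, c⟩
    obtain ⟨h, rfl⟩ := G.φ_surjective e
    exact ⟨(h, c), rfl⟩

end

/-- Vertices of the complete `n`-partite hypergraph: the part number `i` has `m i` vertices. -/
abbrev PartVertex {n : ℕ} (m : Fin n → ℕ) : Type :=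
  (i : Fin n) × Fin (m i)

/-- Hyperedges of the complete `3`-uniform `n`-partite hypergraph: the sets of three vertices that
have at most one vertex in each part. -/
abbrev PartEdge {n : ℕ} (m : Fin n → ℕ) : Type :=
  {s : Finset (PartVertex m) //
    s.card = 3 ∧ ∀ u ∈ s, ∀ v ∈ s, u.1 = v.1 → u = v}

/-- Hinges of the complete `3`-uniform `n`-partite hypergraph: one for each incident pair of a
hyperedge and a vertex. -/
abbrev PartHinge {n : ℕ} (m : Fin n → ℕ) : Type :=
  {p : PartEdge m × PartVertex m // p.2 ∈ p.1.1}

/-- The complete `3`-uniform `n`-partite hypergraph with parts of sizes `m₁, …, m_n`. -/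
def completePartite {n : ℕ} (m : Fin n → ℕ) :
    HingeHypergraph (PartVertex m) (PartEdge m) (PartHinge m) where
  ψ h := h.1.2
  φ h := h.1.1
  φ_surjective := by
    intro e
    have hpos : 0 < e.1.card := by rw [e.2.1]; norm_num
    obtain ⟨v, hv⟩ := Finset.card_pos.mp hpos
    exact ⟨⟨(e, v), hv⟩, rfl⟩

end HingeHypergraph

/-! Necessity is double counting. In a factorization all vertices have the same degree `∑ r i`. The
number of edges at a vertex is an explicit quadratic in the size of its part; equality for two parts
factors as `(m i - m j) * (m i + m j - ∑ m) = 0`, and a third nonempty part makes the second factor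
negative. The divisibility holds because each edge of a factor is counted at three vertices.

Sufficiency builds the factorization by detachment, one part at a time. At the start every edge is a
token with empty trace, and colour `c` owns `r c * M * n / 3` tokens. After `l` parts, `f c A`
counts the edges of colour `c` with trace `A` on these parts. Such an edge still lacks `3 - |A|`
vertices among the `q + 1` remaining parts, so on average a fraction `(3 - |A|) / (q + 1)` of them
should meet the next part. These fractional numbers have integral row sums (over traces) and column
sums (over colours), so they round to integers with the same sums (`exists_int_rounding`); the
result is then shared equally among the `M` vertices of the new part (`exists_equitable_split`). The
invariants of `IsPartialFactorization` survive each step (`IsPartialFactorization.exists_succ`), and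
after `n` parts only traces of size three carry weight. -/

/-! ### Rounding rational matrices with prescribed row and column sums -/

open Finset in
/-- If every nonempty row and every nonempty column of a finite nonempty set `F` of positions has at
least two elements, then there is a nonzero matrix supported on `F` with vanishing row and column
sums. -/
theorem exists_ne_zero_sum_eq_zero {C S : Type*} [Fintype C] [Fintype S] [DecidableEq C]
    [DecidableEq S] (F : Finset (C × S)) (hF : F.Nonempty)
    (hrow : ∀ p ∈ F, ∃ q ∈ F, q ≠ p ∧ q.1 = p.1) (hcol : ∀ p ∈ F, ∃ q ∈ F, q ≠ p ∧ q.2 = p.2) :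
    ∃ d : C → S → ℚ, (∃ p : C × S, d p.1 p.2 ≠ 0) ∧ (∀ c s, (c, s) ∉ F → d c s = 0) ∧
      (∀ c, ∑ s, d c s = 0) ∧ ∀ s, ∑ c, d c s = 0 := by
  obtain ⟨p₀, hp₀⟩ := hF
  have h1 : 2 * (F.image Prod.fst).card ≤ F.card := by
    rw [mul_comm, card_eq_sum_card_image Prod.fst F, ← smul_eq_mul]
    refine card_nsmul_le_sum _ _ _ fun c hc => ?_
    obtain ⟨p, hp, rfl⟩ := mem_image.1 hc
    obtain ⟨q, hq, hqp, h⟩ := hrow p hp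
    exact one_lt_card.2 ⟨q, by simp [hq, h], p, by simp [hp], hqp⟩
  have h2 : 2 * (F.image Prod.snd).card ≤ F.card := by
    rw [mul_comm, card_eq_sum_card_image Prod.snd F, ← smul_eq_mul]
    refine card_nsmul_le_sum _ _ _ fun c hc => ?_
    obtain ⟨p, hp, rfl⟩ := mem_image.1 hc
    obtain ⟨q, hq, hqp, h⟩ := hcol p hp
    exact one_lt_card.2 ⟨q, by simp [hq, h], p, by simp [hp], hqp⟩
  -- One row equation is redundant, since the row sums and the column sums have the same total.
  -- Dropping it leaves fewer equations than the `F.card` unknowns.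
  set R := (F.image Prod.fst).erase p₀.1 with hR
  have hRc : R.card + 1 = (F.image Prod.fst).card :=
    card_erase_add_one (mem_image_of_mem _ hp₀)
  let ext : (F → ℚ) →ₗ[ℚ] (C → S → ℚ) :=
    { toFun := fun x c s => if h : (c, s) ∈ F then x ⟨(c, s), h⟩ else 0
      map_add' := by
        intro x y; ext c s; by_cases h : (c, s) ∈ F <;> simp [h]
      map_smul' := by
        intro x y; ext c s; by_cases h : (c, s) ∈ F <;> simp [h] }
  let L : (F → ℚ) →ₗ[ℚ] ((R → ℚ) × (F.image Prod.snd → ℚ)) :=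
    { toFun := fun x => (fun c => ∑ s, ext x c s, fun s => ∑ c, ext x c s)
      map_add' := by
        intro x y
        ext <;> simp [sum_add_distrib]
      map_smul' := by
        intro x y
        ext <;> simp [mul_sum] }
  have hker : LinearMap.ker L ≠ ⊥ := by
    apply LinearMap.ker_ne_bot_of_finrank_lt
    simp only [Module.finrank_prod, Module.finrank_fintype_fun_eq_card, Fintype.card_coe]
    omega
  obtain ⟨x, hx, hx0⟩ := (Submodule.ne_bot_iff _).1 hker
  have hsupp : ∀ c s, (c, s) ∉ F → ext x c s = 0 := fun c s h => by simp [ext, h]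
  have hLx : L x = 0 := hx
  have hcols : ∀ s, ∑ c, ext x c s = 0 := by
    intro s
    by_cases hs : s ∈ F.image Prod.snd
    · exact congrFun (congrArg Prod.snd hLx) ⟨s, hs⟩
    · refine sum_eq_zero fun c _ => hsupp c s fun h => hs (mem_image_of_mem Prod.snd h)
  have hrows' : ∀ c, c ≠ p₀.1 → ∑ s, ext x c s = 0 := by
    intro c hc0
    by_cases hc : c ∈ F.image Prod.fst
    · exact congrFun (congrArg Prod.fst hLx) ⟨c, mem_erase.2 ⟨hc0, hc⟩⟩
    · refine sum_eq_zero fun s _ => hsupp c s fun h => hc (mem_image_of_mem Prod.fst h)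
  refine ⟨ext x, ?_, hsupp, fun c => ?_, hcols⟩
  · obtain ⟨p, hp⟩ := Function.ne_iff.1 hx0
    exact ⟨p.1, by simpa [ext] using hp⟩
  · by_cases hc : c = p₀.1
    · subst hc
      have : ∑ c, ∑ s, ext x c s = 0 := by
        rw [sum_comm]; exact sum_eq_zero fun s _ => hcols s
      rwa [sum_eq_single p₀.1 (fun c _ h => hrows' c h) (by simp)] at this
    · exact hrows' c hc

/-- A rational number moved in the direction `d ≠ 0`, first meets an integer
at some time; before that it remains between its floor and its ceiling. -/
theorem exists_hitting_time (x d : ℚ) (hd : d ≠ 0) :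
    ∃ t : ℚ, 0 ≤ t ∧ Int.fract (x + t * d) = 0 ∧
      ∀ u, 0 ≤ u → u ≤ t → (⌊x⌋ : ℚ) ≤ x + u * d ∧ x + u * d ≤ ⌈x⌉ := by
  rcases lt_or_gt_of_ne hd with h | h
  · refine ⟨(x - ⌊x⌋) / (-d), div_nonneg (sub_nonneg.2 (Int.floor_le x)) (by linarith), ?_, fun u hu hut => ?_⟩
    · have : x + (x - ⌊x⌋) / (-d) * d = ⌊x⌋ := by field_simp; ring
      rw [this]; simp
    · rw [le_div_iff₀ (by linarith)] at hut
      have := Int.le_ceil x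
      constructor <;> nlinarith
  · refine ⟨(⌈x⌉ - x) / d, div_nonneg (sub_nonneg.2 (Int.le_ceil x)) h.le, ?_, fun u hu hut => ?_⟩
    · have : x + (⌈x⌉ - x) / d * d = ⌈x⌉ := by field_simp; ring
      rw [this]; simp
    · rw [le_div_iff₀ h] at hut
      have := Int.floor_le x
      constructor <;> nlinarith

open Finset in
/-- If a sum is an integer and all summands but one are, then so is the remaining one. -/
theorem fract_eq_zero_of_sum_eq_intCast {T : Type*} [Fintype T] [DecidableEq T] (g : T → ℚ)
    (z : ℤ) (t : T) (hz : ∑ u, g u = z) (hu : ∀ u, u ≠ t → g u = ⌊g u⌋) :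
    Int.fract (g t) = 0 := by
  rw [← add_sum_erase _ _ (mem_univ t),
    sum_congr rfl fun u h => hu u (ne_of_mem_erase h), ← Int.cast_sum] at hz
  rw [eq_sub_of_add_eq hz, ← Int.cast_sub]
  exact Int.fract_intCast _

open Finset in
/-- A rational matrix with integral row and column sums can be rounded to an integral matrix with
the same row and column sums. -/
theorem exists_int_rounding {C S : Type*} [Fintype C] [Fintype S] [DecidableEq C]
    [DecidableEq S] (x : C → S → ℚ) (a : C → ℤ) (b : S → ℤ)
    (ha : ∀ c, ∑ s, x c s = a c) (hb : ∀ s, ∑ c, x c s = b s) :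
    ∃ y : C → S → ℤ, (∀ c s, ⌊x c s⌋ ≤ y c s ∧ y c s ≤ ⌈x c s⌉) ∧
      (∀ c, ∑ s, y c s = a c) ∧ ∀ s, ∑ c, y c s = b s := by
  induction hN : (univ.filter fun p : C × S => Int.fract (x p.1 p.2) ≠ 0).card
    using Nat.strong_induction_on generalizing x with
  | _ N ih =>
  set F := univ.filter fun p : C × S => Int.fract (x p.1 p.2) ≠ 0 with hF
  have hmem : ∀ p : C × S, p ∈ F ↔ Int.fract (x p.1 p.2) ≠ 0 := fun p => by simp [hF]
  have hint : ∀ p : C × S, p ∉ F → x p.1 p.2 = ⌊x p.1 p.2⌋ := fun p hp => by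
    rw [hmem, not_not] at hp
    have := Int.floor_add_fract (x p.1 p.2)
    rw [hp, add_zero] at this
    exact this.symm
  rcases F.eq_empty_or_nonempty with h0 | hne
  · have h : ∀ c s, x c s = ⌊x c s⌋ := fun c s => hint (c, s) (by simp [h0])
    refine ⟨fun c s => ⌊x c s⌋, fun c s => ⟨le_rfl, Int.floor_le_ceil _⟩, fun c => ?_, fun s => ?_⟩
    · have := ha c
      rw [sum_congr rfl fun s _ => h c s] at this
      exact_mod_cast this
    · have := hb s
      rw [sum_congr rfl fun c _ => h c s] at this
      exact_mod_cast this
  obtain ⟨d, ⟨p₁, hp₁⟩, hsupp, hdr, hdc⟩ := exists_ne_zero_sum_eq_zero F hne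
    (fun p hp => by
      by_contra! h
      exact (hmem p).1 hp (fract_eq_zero_of_sum_eq_intCast (fun s => x p.1 s) (a p.1) p.2 (ha p.1) fun u hu =>
        hint (p.1, u) fun hm => h _ hm (fun e => hu (congrArg Prod.snd e)) rfl))
    (fun p hp => by
      by_contra! h
      exact (hmem p).1 hp (fract_eq_zero_of_sum_eq_intCast (fun c => x c p.2) (b p.2) p.1 (hb p.2) fun u hu =>
        hint (u, p.2) fun hm => h _ hm (fun e => hu (congrArg Prod.fst e)) rfl))
  have hdF : ∀ p : C × S, d p.1 p.2 ≠ 0 → p ∈ F := fun p hp => by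
    by_contra h; exact hp (hsupp _ _ h)
  choose τ hτ₀ hτ₁ hτ₂ using fun p : {p : C × S // d p.1 p.2 ≠ 0} =>
    exists_hitting_time (x p.1.1 p.1.2) (d p.1.1 p.1.2) p.2
  -- Stopping at the earliest hitting time keeps every entry between its original floor and ceiling
  -- and makes one more entry integral; integral entries do not move, as `d` vanishes there.
  obtain ⟨p₂, -, hmin⟩ := exists_min_image univ τ ⟨⟨p₁, hp₁⟩, mem_univ _⟩
  have hbox : ∀ c s, (⌊x c s⌋ : ℚ) ≤ x c s + τ p₂ * d c s ∧ x c s + τ p₂ * d c s ≤ ⌈x c s⌉ := by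
    intro c s
    by_cases hd : d c s = 0
    · simp [hd, Int.floor_le, Int.le_ceil]
    · exact hτ₂ ⟨(c, s), hd⟩ _ (hτ₀ _) (hmin ⟨(c, s), hd⟩ (mem_univ _))
  obtain ⟨y, hy, hya, hyb⟩ := ih _ (by
      rw [← hN]
      refine card_lt_card (ssubset_iff_of_subset ?_ |>.2 ⟨p₂.1, hdF _ p₂.2, by simp [hτ₁ p₂]⟩)
      intro p hp
      rw [hmem]
      by_cases hd : d p.1 p.2 = 0
      · simpa [hd] using hp
      · exact (hmem p).1 (hdF p hd))
    (fun c s => x c s + τ p₂ * d c s)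
    (fun c => by simp [sum_add_distrib, ← mul_sum, ha, hdr])
    (fun s => by simp [sum_add_distrib, ← mul_sum, hb, hdc]) rfl
  refine ⟨y, fun c s => ⟨?_, ?_⟩, hya, hyb⟩
  · exact (Int.le_floor.2 (hbox c s).1).trans (hy c s).1
  · exact (hy c s).2.trans (Int.ceil_le.2 (hbox c s).2)

open Finset in
/-- If some nonnegative rational matrix bounded by `u` has row sums `a` and column sums `b`, then so
has some matrix of natural numbers bounded by `u`. -/
theorem exists_nat_rounding {C S : Type*} [Fintype C] [Fintype S] (x : C → S → ℚ)
    (u : C → S → ℕ) (a : C → ℕ) (b : S → ℕ) (hx : ∀ c s, 0 ≤ x c s) (hxu : ∀ c s, x c s ≤ u c s)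
    (ha : ∀ c, ∑ s, x c s = a c) (hb : ∀ s, ∑ c, x c s = b s) :
    ∃ y : C → S → ℕ, (∀ c s, y c s ≤ u c s) ∧
      (∀ c, ∑ s, y c s = a c) ∧ ∀ s, ∑ c, y c s = b s := by
  classical
  obtain ⟨y, hy, hya, hyb⟩ := exists_int_rounding x (fun c => a c) (fun s => b s)
    (by simpa using ha) (by simpa using hb)
  have h0 : ∀ c s, 0 ≤ y c s := fun c s => (Int.floor_nonneg.2 (hx c s)).trans (hy c s).1
  have hc : ∀ c s, ((y c s).toNat : ℤ) = y c s := fun c s => Int.toNat_of_nonneg (h0 c s)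
  refine ⟨fun c s => (y c s).toNat, fun c s => ?_, fun c => ?_, fun s => ?_⟩
  · have : ⌈x c s⌉ ≤ (u c s : ℤ) := Int.ceil_le.2 (by exact_mod_cast hxu c s)
    exact Int.toNat_le.2 ((hy c s).2.trans this)
  · zify; simp only [hc, hya]
  · zify; simp only [hc, hyb]

open Finset in
/-- A matrix of natural numbers whose row and column sums are divisible by `t` is the sum of `t`
matrices with the same row sums and the same column sums. -/
theorem exists_equitable_split {C S : Type*} [Fintype C] [Fintype S] (t : ℕ) (G : C → S → ℕ)
    (a : C → ℕ) (b : S → ℕ) (ha : ∀ c, ∑ s, G c s = t * a c) (hb : ∀ s, ∑ c, G c s = t * b s) :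
    ∃ g : Fin t → C → S → ℕ, (∀ c s, ∑ j, g j c s = G c s) ∧
      (∀ j c, ∑ s, g j c s = a c) ∧ ∀ j s, ∑ c, g j c s = b s := by
  induction t generalizing G with
  | zero =>
    refine ⟨fun _ _ _ => 0, fun c s => ?_, fun j => j.elim0, fun j => j.elim0⟩
    have := ha c
    rw [zero_mul, sum_eq_zero_iff] at this
    simp [this s (mem_univ s)]
  | succ t ih =>
    -- Rounding `G / (t + 1)` splits off one share; the bound by `G` keeps the remainder
    -- nonnegative.
    obtain ⟨y, hyG, hya, hyb⟩ := exists_nat_rounding (fun c s => (G c s : ℚ) / (t + 1)) G a b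
      (fun c s => by positivity)
      (fun c s => div_le_self (by positivity) (by simp))
      (fun c => by
        rw [← sum_div, ← Nat.cast_sum, ha]; push_cast; field_simp)
      (fun s => by
        rw [← sum_div, ← Nat.cast_sum, hb]; push_cast; field_simp)
    obtain ⟨g, hg, hga, hgb⟩ := ih (fun c s => G c s - y c s)
      (fun c => by
        rw [sum_tsub_distrib _ fun s _ => hyG c s, ha, hya, add_mul, one_mul, Nat.add_sub_cancel])
      (fun s => by
        rw [sum_tsub_distrib _ fun c _ => hyG c s, hb, hyb, add_mul, one_mul, Nat.add_sub_cancel])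
    refine ⟨Fin.cons y g, fun c s => ?_, fun j c => ?_, fun j s => ?_⟩
    · rw [Fin.sum_univ_succ]
      simp [hg, Nat.add_sub_cancel' (hyG c s)]
    · refine Fin.cases ?_ (fun j => ?_) j <;> simp [hya, hga]
    · refine Fin.cases ?_ (fun j => ?_) j <;> simp [hyb, hgb]

/-! ### Partial factorizations and their extension by one part -/

/-- The number of coordinates at which a partial function is defined. -/
def numSome {l : ℕ} {T : Type*} (A : Fin l → Option T) : ℕ :=
  ∑ i, if (A i).isSome then 1 else 0

theorem numSome_snoc_none {l : ℕ} {T : Type*} (A : Fin l → Option T) :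
    numSome (Fin.snoc A none : Fin (l + 1) → Option T) = numSome A := by
  rw [numSome, Fin.sum_univ_castSucc]
  simp [numSome]

theorem numSome_snoc_some {l : ℕ} {T : Type*} (A : Fin l → Option T) (t : T) :
    numSome (Fin.snoc A (some t) : Fin (l + 1) → Option T) = numSome A + 1 := by
  rw [numSome, Fin.sum_univ_castSucc]
  simp [numSome]

theorem sum_snoc_option {l : ℕ} {T N : Type*} [Fintype T] [AddCommMonoid N]
    (F : (Fin (l + 1) → Option T) → N) :
    ∑ A, F A = ∑ A : Fin l → Option T, (F (Fin.snoc A none) + ∑ t, F (Fin.snoc A (some t))) := by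
  rw [← (Fin.snocEquiv fun _ => Option T).sum_comp F, Fintype.sum_prod_type, Finset.sum_comm]
  refine Finset.sum_congr rfl fun A _ => ?_
  rw [Fintype.sum_option]
  rfl

/-- The number of ways of extending a set of `s ≤ 3` vertices to a set of three vertices by adding
vertices from distinct members of a family of `q` sets of size `M`, times `lam`. -/
def extensionCount (lam M q s : ℕ) : ℕ :=
  if s ≤ 3 then lam * q.choose (3 - s) * M ^ (3 - s) else 0

/-- Pascal's rule: an extension either avoids the new set or uses one of its `M` elements. -/
theorem extensionCount_succ (lam M q s : ℕ) :
    extensionCount lam M (q + 1) s =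
      extensionCount lam M q s + M * extensionCount lam M q (s + 1) := by
  unfold extensionCount
  rcases lt_or_ge s 3 with h | h
  · obtain ⟨t, ht⟩ : ∃ t, 3 - s = t + 1 := ⟨2 - s, by omega⟩
    have ht' : 3 - (s + 1) = t := by omega
    rw [if_pos h.le, if_pos h.le, if_pos (by omega), ht, ht', Nat.choose_succ_succ]
    ring
  · rcases h.eq_or_lt with rfl | h
    · simp
    · simp [h.not_ge, (Nat.lt_succ_of_lt h).not_ge]

/-- Counts pairs of an extension and one of its `3 - s` added vertices; by symmetry each of the `q +
1` sets contributes equally. -/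
theorem succ_mul_extensionCount (lam M q s : ℕ) :
    (q + 1) * (M * extensionCount lam M q (s + 1)) =
      extensionCount lam M (q + 1) s * (3 - s) := by
  unfold extensionCount
  rcases lt_or_ge s 3 with h | h
  · obtain ⟨t, ht⟩ : ∃ t, 3 - s = t + 1 := ⟨2 - s, by omega⟩
    have ht' : 3 - (s + 1) = t := by omega
    rw [if_pos h.le, if_pos (by omega), ht, ht']
    have := Nat.add_one_mul_choose_eq q t
    linear_combination lam * M ^ (t + 1) * this
  · have : 3 - s = 0 := by omega
    simp [this, show ¬ (s + 1 ≤ 3) by omega]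

theorem three_sub_le_of_extensionCount_ne_zero {lam M q s : ℕ}
    (h : extensionCount lam M q s ≠ 0) : 3 - s ≤ q := by
  by_contra! hq
  apply h
  simp [extensionCount, Nat.choose_eq_zero_of_lt hq]

/-- A distribution of weighted partial transversals of `l` sets of size `M` over colour classes, in
which every vertex has degree `r c` in colour `c`, and which is compatible with an extension by `q`
further sets of size `M`. -/
structure IsPartialFactorization {C : Type*} [Fintype C] (lam M q l : ℕ) (r : C → ℕ)
    (f : C → (Fin l → Option (Fin M)) → ℕ) : Prop where
  sum_color : ∀ A, ∑ c, f c A = extensionCount lam M q (numSome A)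
  degree : ∀ c i a, ∑ A, (if A i = some a then f c A else 0) = r c
  sum_missing : ∀ c, ∑ A, f c A * (3 - numSome A) = r c * M * q

-- Here `g j c A` is the number of edges of colour `c` and trace `A` that receive vertex `j` of the
-- new part. The new part is first treated as a single vertex of degree `M * r c`, then split into
-- `M` vertices.
open Finset in
theorem IsPartialFactorization.exists_selection {C : Type*} [Fintype C] {lam M q l : ℕ}
    {r : C → ℕ} {f : C → (Fin l → Option (Fin M)) → ℕ}
    (hf : IsPartialFactorization lam M (q + 1) l r f) :
    ∃ g : Fin M → C → (Fin l → Option (Fin M)) → ℕ, (∀ c A, ∑ j, g j c A ≤ f c A) ∧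
      (∀ j c, ∑ A, g j c A = r c) ∧
      ∀ j A, ∑ c, g j c A = extensionCount lam M q (numSome A + 1) := by
  obtain ⟨G, hGf, hGa, hGb⟩ := exists_nat_rounding
    (fun c A => ((f c A * (3 - numSome A) : ℕ) : ℚ) / (q + 1)) f (fun c => M * r c)
    (fun A => M * extensionCount lam M q (numSome A + 1))
    (fun c A => by positivity)
    (fun c A => by
      rw [div_le_iff₀ (by positivity)]
      -- The fraction is at most one wherever `f c A` is positive: a trace that occurs can be
      -- completed, so it lacks at most `q + 1` vertices.
      rcases Nat.eq_zero_or_pos (f c A) with h | h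
      · simp [h]
      · have h1 : extensionCount lam M (q + 1) (numSome A) ≠ 0 := by
          rw [← hf.sum_color]
          exact (h.trans_le (single_le_sum (f := fun c => f c A)
            (fun _ _ => Nat.zero_le _) (mem_univ c))).ne'
        have h2 := three_sub_le_of_extensionCount_ne_zero h1
        exact_mod_cast Nat.mul_le_mul_left (f c A) h2)
    (fun c => by
      rw [← sum_div, ← Nat.cast_sum, hf.sum_missing]; push_cast; field_simp)
    (fun A => by
      rw [← sum_div, ← Nat.cast_sum, ← sum_mul, hf.sum_color, ← succ_mul_extensionCount]
      push_cast; field_simp)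
  obtain ⟨g, hg, hga, hgb⟩ := exists_equitable_split M G r _ hGa hGb
  exact ⟨g, fun c A => (hg c A).trans_le (hGf c A), hga, hgb⟩

open Finset in
theorem IsPartialFactorization.exists_succ {C : Type*} [Fintype C] {lam M q l : ℕ}
    {r : C → ℕ} {f : C → (Fin l → Option (Fin M)) → ℕ}
    (hf : IsPartialFactorization lam M (q + 1) l r f) :
    ∃ f', IsPartialFactorization lam M q (l + 1) r f' := by
  obtain ⟨g, hgf, hga, hgb⟩ := hf.exists_selection
  let f' : C → (Fin (l + 1) → Option (Fin M)) → ℕ := fun c A =>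
    (A (Fin.last l)).elim (f c (Fin.init A) - ∑ j, g j c (Fin.init A))
      (fun j => g j c (Fin.init A))
  have hnone : ∀ c A, f' c (Fin.snoc A none) = f c A - ∑ j, g j c A := by
    intro c A; simp [f']
  have hsome : ∀ c A j, f' c (Fin.snoc A (some j)) = g j c A := by
    intro c A j; simp [f']
  have hsum : ∀ c A, f' c (Fin.snoc A none) + ∑ j, g j c A = f c A := by
    intro c A; rw [hnone, Nat.sub_add_cancel (hgf c A)]
  refine ⟨f', fun A => ?_, fun c i a => ?_, fun c => ?_⟩
  · rw [← Fin.snoc_init_self A]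
    generalize Fin.init A = B
    rcases A (Fin.last l) with _ | j
    · rw [numSome_snoc_none]
      have h1 : ∑ c, f' c (Fin.snoc B none) + ∑ c, ∑ j, g j c B =
          extensionCount lam M (q + 1) (numSome B) := by
        rw [← sum_add_distrib, ← hf.sum_color]
        exact sum_congr rfl fun c _ => hsum c B
      rw [sum_comm, sum_congr rfl fun j _ => hgb j B, extensionCount_succ] at h1
      simpa using h1
    · rw [numSome_snoc_some, ← hgb j]
      exact sum_congr rfl fun c _ => hsome c B j
  · rw [sum_snoc_option]
    refine Fin.lastCases ?_ (fun i => ?_) i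
    · rw [← hga a c]
      refine sum_congr rfl fun A _ => ?_
      simp [hsome]
    · rw [← hf.degree c i a]
      refine sum_congr rfl fun A _ => ?_
      simp only [Fin.snoc_castSucc, hsome]
      split_ifs
      · exact hsum c A
      · simp
  · rw [sum_snoc_option]
    simp only [numSome_snoc_none, numSome_snoc_some, hsome]
    have h1 := hf.sum_missing c
    have h2 : ∑ A, ((f' c (Fin.snoc A none) * (3 - numSome A) +
        ∑ j, g j c A * (3 - (numSome A + 1))) + ∑ j, g j c A) =
        ∑ A, f c A * (3 - numSome A) := by
      refine sum_congr rfl fun A _ => ?_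
      rw [← hsum c A, add_mul, add_assoc, ← sum_mul]
      congr 1
      rcases lt_or_ge (numSome A) 3 with h | h
      · rw [show 3 - numSome A = 3 - (numSome A + 1) + 1 by omega]; ring
      -- A trace with three or more vertices is never extended, so the truncated subtraction does no
      -- harm.
      · have h0 : ∑ j, g j c A = 0 := by
          refine sum_eq_zero fun j _ => ?_
          have := hgb j A
          rw [extensionCount, if_neg (by omega)] at this
          exact (sum_eq_zero_iff.1 this) c (mem_univ c)
        simp [h0]
    rw [h1, sum_add_distrib, sum_comm (s := univ) (f := fun A j => g j c A),
      sum_congr rfl fun j _ => hga j c] at h2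
    simp only [sum_const, card_univ, Fintype.card_fin, smul_eq_mul] at h2
    linarith

theorem exists_isPartialFactorization {C : Type*} [Fintype C] {lam M n : ℕ} {r : C → ℕ}
    (hdvd : ∀ c, 3 ∣ r c * M * n) (hsum : 3 * lam * n.choose 3 * M ^ 3 = (∑ c, r c) * M * n) :
    ∃ f : C → (Fin n → Option (Fin M)) → ℕ, IsPartialFactorization lam M 0 n r f := by
  suffices h : ∀ l q, l + q = n → ∃ f : C → (Fin l → Option (Fin M)) → ℕ,
      IsPartialFactorization lam M q l r f from h n 0 rfl
  intro l
  induction l with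
  | zero =>
    rintro q hq
    obtain rfl : q = n := by omega
    -- With no part yet, the empty trace carries all edges; `hdvd` makes the division exact.
    refine ⟨fun c _ => r c * M * q / 3, fun A => ?_, fun c i => i.elim0, fun c => ?_⟩
    · have : 3 * ∑ c, r c * M * q / 3 = 3 * extensionCount lam M q 0 := by
        rw [Finset.mul_sum, Finset.sum_congr rfl fun c _ => Nat.mul_div_cancel' (hdvd c),
          ← Finset.sum_mul, ← Finset.sum_mul, ← hsum]
        simp [extensionCount, mul_assoc]
      simpa [numSome] using this
    · simp [numSome, Nat.div_mul_cancel (hdvd c)]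
  | succ l ih =>
    intro q hq
    obtain ⟨f, hf⟩ := ih (q + 1) (by omega)
    exact hf.exists_succ

/-! ### From weights on partial transversals to factors -/

namespace HingeHypergraph

open Finset

open Classical in
theorem degree_spanningSub_multiple {n : ℕ} (m : Fin n → ℕ) (lam : ℕ)
    (S : Set (PartEdge m × Fin lam)) (v : PartVertex m) :
    ((multiple lam (completePartite m)).spanningSub S).degree v =
      ∑ p : PartEdge m × Fin lam, if p ∈ S ∧ v ∈ p.1.1 then 1 else 0 := by
  rw [← card_filter, ← Fintype.card_subtype, ← Nat.card_eq_fintype_card, degree]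
  refine Nat.card_congr
    { toFun := fun h => ⟨(h.1.1.1.1.1, h.1.1.2), h.1.2, ?_⟩
      invFun := fun p => ⟨⟨(⟨(p.1.1, v), p.2.2⟩, p.1.2), p.2.1⟩, rfl⟩
      left_inv := ?_
      right_inv := fun p => rfl }
  · have h1 := h.1.1.1.2
    have h2 : h.1.1.1.1.2 = v := h.2
    rwa [h2] at h1
  · rintro ⟨⟨⟨⟨⟨e, w⟩, hw⟩, c⟩, hS⟩, h⟩
    have h2 : w = v := h
    subst h2
    rfl

/-- The partial transversal, as a set of vertices, given by a partial choice function. -/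
def chosenVertices {n M : ℕ} (A : Fin n → Option (Fin M)) :
    Finset (PartVertex fun _ : Fin n => M) :=
  univ.filter fun v => A v.1 = some v.2

theorem mem_chosenVertices {n M : ℕ} {A : Fin n → Option (Fin M)}
    {v : PartVertex fun _ : Fin n => M} : v ∈ chosenVertices A ↔ A v.1 = some v.2 := by
  simp [chosenVertices]

theorem card_chosenVertices {n M : ℕ} (A : Fin n → Option (Fin M)) :
    (chosenVertices A).card = numSome A := by
  rw [chosenVertices, card_filter, Fintype.sum_sigma, numSome]
  refine sum_congr rfl fun i _ => ?_
  rcases h : A i with _ | a <;> simp [h]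

theorem exists_chosenVertices_eq {n M : ℕ} (e : PartEdge fun _ : Fin n => M) :
    ∃ A : Fin n → Option (Fin M), chosenVertices A = e.1 := by
  classical
  refine ⟨fun i => if h : ∃ a, (⟨i, a⟩ : PartVertex fun _ : Fin n => M) ∈ e.1
    then some h.choose else none, ?_⟩
  ext ⟨i, a⟩
  rw [mem_chosenVertices]
  by_cases h : ∃ a, (⟨i, a⟩ : PartVertex fun _ : Fin n => M) ∈ e.1
  · simp only [h, dite_true, Option.some_inj]
    constructor
    · intro ha
      rw [← ha]
      exact h.choose_spec
    · intro ha
      simpa using e.2.2 _ h.choose_spec _ ha rfl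
  · simp only [h, dite_false, reduceCtorEq, false_iff]
    exact fun ha => h ⟨a, ha⟩

/-- Sums over the hyperedges containing a vertex, in terms of partial choice functions. -/
theorem exists_weights {C : Type*} [Fintype C] {lam M n : ℕ} {r : C → ℕ}
    {f : C → (Fin n → Option (Fin M)) → ℕ} (hf : IsPartialFactorization lam M 0 n r f) :
    ∃ w : C → PartEdge (fun _ : Fin n => M) → ℕ, (∀ e, ∑ c, w c e = lam) ∧
      ∀ c v, ∑ e, (if v ∈ e.1 then w c e else 0) = r c := by
  choose F hF using exists_chosenVertices_eq (n := n) (M := M)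
  have hcard : ∀ e, numSome (F e) = 3 := fun e => by rw [← card_chosenVertices, hF, e.2.1]
  refine ⟨fun c e => f c (F e), fun e => ?_, fun c v => ?_⟩
  · rw [hf.sum_color, hcard]
    simp [extensionCount]
  · rw [← hf.degree c v.1 v.2]
    refine Fintype.sum_of_injective F (fun e e' h => Subtype.ext ?_) _ _ (fun A hA => ?_)
      fun e => ?_
    · rw [← hF e, ← hF e', h]
    · have h3 : numSome A ≠ 3 := by
        intro h
        let e : PartEdge fun _ : Fin n => M := ⟨chosenVertices A, by rw [card_chosenVertices, h], by
          rintro ⟨i, a⟩ hu ⟨j, b⟩ hv huv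
          obtain rfl : i = j := huv
          rw [mem_chosenVertices] at hu hv
          exact congrArg (Sigma.mk i) (Option.some_inj.1 (hu.symm.trans hv))⟩
        refine hA ⟨e, funext fun i => Option.ext fun a => ?_⟩
        have := Finset.ext_iff.1 (hF e) ⟨i, a⟩
        rwa [mem_chosenVertices, mem_chosenVertices] at this
      -- With no part left, traces below size three cannot be completed, and larger ones are
      -- excluded by the guard in `extensionCount`.
      have h0 : extensionCount lam M 0 (numSome A) = 0 := by
        by_contra h
        have := three_sub_le_of_extensionCount_ne_zero h
        apply h
        rw [extensionCount, if_neg (by omega)]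
      rw [← hf.sum_color, sum_eq_zero_iff] at h0
      simp [h0 c (mem_univ c)]
    · simp only [← mem_chosenVertices (A := F e), hF]

theorem exists_coloring_card_eq {C : Type*} [Fintype C] [DecidableEq C] {N : ℕ} (w : C → ℕ)
    (h : ∑ c, w c = N) :
    ∃ col : Fin N → C, ∀ c, ∑ j, (if col j = c then 1 else 0) = w c := by
  have e : Fin N ≃ (c : C) × Fin (w c) := Fintype.equivOfCardEq (by simp [h])
  refine ⟨fun j => (e j).1, fun c => ?_⟩
  rw [e.sum_comp fun x => if x.1 = c then 1 else 0, Fintype.sum_sigma,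
    sum_eq_single c (fun x _ h => by simp [h]) (by simp)]
  simp

theorem isFactorizable_of_weights {n : ℕ} {m : Fin n → ℕ} {lam k : ℕ} {r : Fin k → ℕ}
    (w : Fin k → PartEdge m → ℕ) (hw : ∀ e, ∑ c, w c e = lam)
    (hr : ∀ c v, ∑ e, (if v ∈ e.1 then w c e else 0) = r c) :
    (multiple lam (completePartite m)).IsFactorizable r := by
  choose col hcol using fun e => exists_coloring_card_eq (fun c => w c e) (hw e)
  refine ⟨fun c => {p | col p.1 p.2 = c}, fun i j hij => ?_, ?_, fun c v => ?_⟩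
  · refine Set.disjoint_left.2 fun p hi hj => hij ?_
    exact hi.symm.trans hj
  · ext p
    simp
  · rw [degree_spanningSub_multiple, Fintype.sum_prod_type, ← hr c v]
    refine sum_congr rfl fun e _ => ?_
    by_cases hv : v ∈ e.1
    · simpa [hv] using hcol e c
    · simp [hv]

/-! ### Necessary conditions by counting degrees -/

open Classical in
theorem sum_eq_of_isFactorizable {n : ℕ} {m : Fin n → ℕ} {lam k : ℕ} {r : Fin k → ℕ}
    (h : (multiple lam (completePartite m)).IsFactorizable r) (v : PartVertex m) :
    ∑ i, r i = lam * (univ.filter fun e : PartEdge m => v ∈ e.1).card := by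
  obtain ⟨A, hA, hU, hr⟩ := h
  have hr' : ∀ i, ∑ p : PartEdge m × Fin lam, (if p ∈ A i ∧ v ∈ p.1.1 then 1 else 0) = r i :=
    fun i => by rw [← hr i v, degree_spanningSub_multiple]
  rw [← sum_congr rfl fun i _ => hr' i, sum_comm, card_filter, mul_sum, Fintype.sum_prod_type]
  refine sum_congr rfl fun e _ => ?_
  have : ∀ j : Fin lam, ∑ i, (if (e, j) ∈ A i ∧ v ∈ e.1 then 1 else 0) =
      if v ∈ e.1 then 1 else 0 := by
    intro j
    obtain ⟨i, hi⟩ : ∃ i, (e, j) ∈ A i := by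
      have : (e, j) ∈ ⋃ i, A i := hU ▸ Set.mem_univ _
      simpa using this
    rw [sum_eq_single i (fun i' _ hi' => ?_) (by simp)]
    · simp [hi]
    · rw [if_neg fun h => Set.disjoint_left.1 (hA i' i hi') h.1 hi]
  rw [sum_congr rfl fun j _ => this j]
  simp

open Classical in
theorem three_dvd_of_isFactor {n : ℕ} {m : Fin n → ℕ} {lam r : ℕ}
    {S : Set (PartEdge m × Fin lam)}
    (h : (multiple lam (completePartite m)).IsFactor r S) : 3 ∣ r * ∑ i, m i := by
  have h1 : ∀ v, ∑ p : PartEdge m × Fin lam, (if p ∈ S ∧ v ∈ p.1.1 then 1 else 0) = r :=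
    fun v => by rw [← h v, degree_spanningSub_multiple]
  have h2 : r * ∑ i, m i = ∑ v : PartVertex m, r := by simp [mul_comm]
  rw [h2, ← sum_congr rfl fun v _ => h1 v, sum_comm]
  refine dvd_sum fun p _ => ?_
  by_cases hp : p ∈ S
  · simp [hp, p.1.2.1]
  · simp [hp]

open Classical in
/-- Twice the number of hyperedges containing `v` is the number of ordered pairs of vertices lying,
together with `v`, in three different parts. -/
theorem two_mul_card_edges {n : ℕ} {m : Fin n → ℕ} (v : PartVertex m) :
    2 * (univ.filter fun e : PartEdge m => v ∈ e.1).card =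
      (univ.filter fun p : PartVertex m × PartVertex m =>
        p.1.1 ≠ v.1 ∧ p.2.1 ≠ v.1 ∧ p.1.1 ≠ p.2.1).card := by
  have h1 : ∀ e ∈ univ.filter (fun e : PartEdge m => v ∈ e.1),
      ((e.1.erase v).offDiag).card = 2 := by
    intro e he
    rw [offDiag_card, card_erase_of_mem (by simpa using he), e.2.1]
  rw [mul_comm, ← smul_eq_mul, ← sum_const, ← sum_congr rfl h1, ← card_sigma]
  refine card_bij' (fun x _ => x.2) (fun p hp => ⟨⟨{v, p.1, p.2}, ?_, ?_⟩, p⟩) ?_ ?_ ?_ ?_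
  · simp only [mem_filter, mem_univ, true_and] at hp
    obtain ⟨h1, h2, h3⟩ := hp
    exact card_eq_three.2 ⟨v, p.1, p.2, fun h => h1 (by rw [h]), fun h => h2 (by rw [h]),
      fun h => h3 (by rw [h]), rfl⟩
  · simp only [mem_filter, mem_univ, true_and] at hp
    obtain ⟨h1, h2, h3⟩ := hp
    intro a ha b hb hab
    simp only [mem_insert, mem_singleton] at ha hb
    rcases ha with rfl | rfl | rfl <;> rcases hb with rfl | rfl | rfl <;>
      first | rfl | exact absurd hab ‹_› | exact absurd hab.symm ‹_›
  · rintro ⟨e, p⟩ h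
    simp only [mem_sigma, mem_filter, mem_univ, true_and, mem_offDiag, mem_erase] at h ⊢
    obtain ⟨hv, ⟨h1, h1'⟩, ⟨h2, h2'⟩, h3⟩ := h
    exact ⟨fun h => h1 (e.2.2 _ h1' _ hv h), fun h => h2 (e.2.2 _ h2' _ hv h),
      fun h => h3 (e.2.2 _ h1' _ h2' h)⟩
  · intro p hp
    simp only [mem_filter, mem_univ, true_and] at hp
    obtain ⟨h1, h2, h3⟩ := hp
    simp only [mem_sigma, mem_filter, mem_univ, true_and, mem_offDiag, mem_erase]
    simp only [mem_insert, mem_singleton, true_or, or_true, and_true, true_and]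
    exact ⟨fun h => h1 (by rw [h]), fun h => h2 (by rw [h]), fun h => h3 (by rw [h])⟩
  · rintro ⟨e, p⟩ h
    simp only [mem_sigma, mem_filter, mem_univ, true_and, mem_offDiag, mem_erase] at h
    obtain ⟨hv, ⟨h1, h1'⟩, ⟨h2, h2'⟩, h3⟩ := h
    have : ({v, p.1, p.2} : Finset (PartVertex m)) = e.1 := by
      refine eq_of_subset_of_card_le ?_ ?_
      · simp [insert_subset_iff, hv, h1', h2']
      · rw [e.2.1, card_eq_three.2 ⟨v, p.1, p.2, h1.symm, h2.symm, h3, rfl⟩]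
    simp only [Sigma.mk.injEq, heq_eq_eq, and_true]
    exact Subtype.ext this
  · intro p hp
    rfl

open Classical in
theorem two_mul_card_edges_eq {n : ℕ} (m : Fin n → ℕ) (v : PartVertex m) :
    (2 * (univ.filter fun e : PartEdge m => v ∈ e.1).card : ℤ) =
      (∑ i, (m i : ℤ)) ^ 2 - 2 * (∑ i, (m i : ℤ)) * m v.1 + 2 * (m v.1 : ℤ) ^ 2
        - ∑ i, (m i : ℤ) ^ 2 := by
  have h1 := two_mul_card_edges v
  rw [card_filter fun p : PartVertex m × PartVertex m =>
    p.1.1 ≠ v.1 ∧ p.2.1 ≠ v.1 ∧ p.1.1 ≠ p.2.1, Fintype.sum_prod_type] at h1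
  zify at h1
  -- When `x` lies outside the part of `v`, the two excluded parts for `y` are distinct, so their
  -- indicators simply subtract.
  have h2 : ∀ x y : PartVertex m,
      ((if x.1 ≠ v.1 ∧ y.1 ≠ v.1 ∧ x.1 ≠ y.1 then 1 else 0 : ℤ)) =
        (if x.1 = v.1 then 0 else 1) *
          (1 - (if y.1 = v.1 then 1 else 0) - (if y.1 = x.1 then 1 else 0)) := by
    intro x y
    by_cases h : x.1 = v.1
    · simp [h]
    · by_cases h' : y.1 = v.1
      · simp [h, h', Ne.symm h]
      · by_cases h'' : y.1 = x.1
        · simp [h'']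
        · simp [h, h', h'', Ne.symm h'']
  have h3 : ∀ i, ∑ y : PartVertex m, (if y.1 = i then 1 else 0 : ℤ) = m i := by
    intro i
    rw [Fintype.sum_sigma, sum_eq_single i (fun x _ h => by simp [h]) (by simp)]
    simp
  have h4 : ∀ i : Fin n, (if i = v.1 then 0 else 1 : ℤ) = 1 - if i = v.1 then 1 else 0 := by
    intro i; split_ifs <;> simp
  have h5 : ∀ x : PartVertex m, ∑ y : PartVertex m,
      ((if x.1 ≠ v.1 ∧ y.1 ≠ v.1 ∧ x.1 ≠ y.1 then 1 else 0 : ℤ)) =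
        (if x.1 = v.1 then 0 else 1) * (∑ i, (m i : ℤ) - m v.1 - m x.1) := by
    intro x
    rw [sum_congr rfl fun y _ => h2 x y, ← mul_sum, sum_sub_distrib, sum_sub_distrib, h3, h3]
    simp
  rw [sum_congr rfl fun x _ => h5 x, Fintype.sum_sigma] at h1
  rw [h1]
  simp only [h4, sum_const, card_univ, Fintype.card_fin, nsmul_eq_mul]
  have h6 : ∀ i : Fin n, (m i : ℤ) * ((1 - if i = v.1 then 1 else 0) *
      (∑ i, (m i : ℤ) - m v.1 - m i)) = m i * (∑ i, (m i : ℤ) - m v.1) - (m i : ℤ) ^ 2 -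
        if i = v.1 then m i * (∑ i, (m i : ℤ) - m v.1 - m i) else 0 := by
    intro i
    split_ifs <;> ring
  rw [sum_congr rfl fun i _ => h6 i, sum_sub_distrib, sum_sub_distrib, ← sum_mul, sum_ite_eq',
    if_pos (mem_univ _)]
  ring

end HingeHypergraph

open HingeHypergraph Finset in
theorem part_sizes_eq {n : ℕ} (hn : 3 ≤ n) {m : Fin n → ℕ} (hm : ∀ i, 0 < m i) (i j : Fin n)
    (h : (∑ i, (m i : ℤ)) ^ 2 - 2 * (∑ i, (m i : ℤ)) * m i + 2 * (m i : ℤ) ^ 2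
        - ∑ i, (m i : ℤ) ^ 2 = (∑ i, (m i : ℤ)) ^ 2 - 2 * (∑ i, (m i : ℤ)) * m j
        + 2 * (m j : ℤ) ^ 2 - ∑ i, (m i : ℤ) ^ 2) : m i = m j := by
  by_contra hne
  have hij : i ≠ j := fun h => hne (by rw [h])
  obtain ⟨l, hl⟩ : ∃ l, l ∉ ({i, j} : Finset (Fin n)) := by
    by_contra! hall
    have h1 := card_le_card (fun x _ => hall x : (univ : Finset (Fin n)) ⊆ {i, j})
    have h2 := card_le_two (a := i) (b := j)
    simp at h1
    omega
  have h1 : ∑ x ∈ insert l {i, j}, (m x : ℤ) ≤ ∑ x, (m x : ℤ) :=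
    sum_le_sum_of_subset_of_nonneg (subset_univ _) fun _ _ _ => by positivity
  rw [sum_insert hl, sum_pair hij] at h1
  have h2 := hm l
  -- The second factor is at most `-m l`, hence nonzero.
  have h3 : 2 * (((m i : ℤ) - m j) * (m i + m j - ∑ i, (m i : ℤ))) = 0 := by
    linear_combination h
  rcases mul_eq_zero.1 ((mul_eq_zero.1 h3).resolve_left two_ne_zero) with h4 | h4
  · exact hne (by omega)
  · omega

theorem two_mul_choose_two (n : ℕ) (hn : 1 ≤ n) :
    (2 * ((n - 1).choose 2 : ℕ) : ℤ) = ((n : ℤ) - 1) * (n - 2) := by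
  obtain ⟨t, rfl⟩ := Nat.exists_eq_add_of_le' hn
  rw [Nat.add_sub_cancel, Nat.choose_two_right]
  have := Nat.div_mul_cancel (Nat.even_mul_pred_self t).two_dvd
  rcases t with _ | t
  · simp
  · rw [Nat.add_sub_cancel] at this ⊢
    zify at this
    push_cast at this ⊢
    linarith

theorem theorem4p2 (n : ℕ) (hn : 3 ≤ n) (m : Fin n → ℕ) (hm : ∀ i, 0 < m i)
    (lam : ℕ) (hlam : 0 < lam) (k : ℕ) (r : Fin k → ℕ) (hr : ∀ i, 0 < r i) :
    (HingeHypergraph.multiple lam (HingeHypergraph.completePartite m)).IsFactorizable r ↔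
      ∃ M : ℕ, (∀ i, m i = M) ∧ (∀ i, 3 ∣ r i * M * n) ∧
        ∑ i, r i = lam * (n - 1).choose 2 * M ^ 2 := by
  classical
  constructor
  · intro h
    let i₀ : Fin n := ⟨0, by omega⟩
    have hd : ∀ i j : Fin n, m i = m j := by
      intro i j
      refine part_sizes_eq hn hm i j ?_
      have h1 := HingeHypergraph.sum_eq_of_isFactorizable h ⟨i, ⟨0, hm i⟩⟩
      have h2 := HingeHypergraph.sum_eq_of_isFactorizable h ⟨j, ⟨0, hm j⟩⟩
      have h3 := Nat.eq_of_mul_eq_mul_left hlam (h1.symm.trans h2)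
      rw [← HingeHypergraph.two_mul_card_edges_eq m ⟨i, ⟨0, hm i⟩⟩,
        ← HingeHypergraph.two_mul_card_edges_eq m ⟨j, ⟨0, hm j⟩⟩, h3]
    obtain ⟨M, hM⟩ : ∃ M, ∀ i, m i = M := ⟨m i₀, fun i => hd i i₀⟩
    refine ⟨M, hM, fun i => ?_, ?_⟩
    · obtain ⟨A, -, -, hA⟩ := h
      have := HingeHypergraph.three_dvd_of_isFactor (hA i)
      simpa [hM, mul_comm, mul_assoc, mul_left_comm] using this
    · have h1 := HingeHypergraph.two_mul_card_edges_eq m ⟨i₀, ⟨0, hm i₀⟩⟩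
      rw [HingeHypergraph.sum_eq_of_isFactorizable h ⟨i₀, ⟨0, hm i₀⟩⟩, mul_assoc]
      congr 1
      simp only [hM, Finset.sum_const, Finset.card_univ, Fintype.card_fin, nsmul_eq_mul] at h1
      have h2 := two_mul_choose_two n (by omega)
      zify
      have h3 : (2 : ℤ) ≠ 0 := by norm_num
      apply mul_left_cancel₀ h3
      rw [h1]
      linear_combination -(M : ℤ) ^ 2 * h2
  · rintro ⟨M, hM, hdvd, hsum⟩
    obtain rfl : m = fun _ => M := funext hM
    obtain ⟨f, hf⟩ := exists_isPartialFactorization (lam := lam) hdvd (by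
      obtain ⟨t, rfl⟩ := Nat.exists_eq_add_of_le' (show 1 ≤ n by omega)
      rw [hsum, Nat.add_sub_cancel]
      -- The identity `n * (n - 1).choose 2 = 3 * n.choose 3` turns the degree condition into the
      -- count of all incidences.
      have := Nat.add_one_mul_choose_eq t 2
      linear_combination lam * M ^ 3 * this.symm)
    obtain ⟨w, hw, hwr⟩ := HingeHypergraph.exists_weights hf
    exact HingeHypergraph.isFactorizable_of_weights w hw hwr
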